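/- Let $f=(f_1,f_2):\mathbb{R}^2\to\mathbb{R}^2$ be a (global) symplectomorphism, i.e. a $C^\infty$ diffeomorphism of $\mathbb{R}^2$ onto itself with $f^*\omega=\omega$ for the standard symplectic form $\omega=dx\wedge dy$. Let $Jf$ be its Jacobian matrix and let $$\|Jf\|=\Big(\sum_{i=1}^{2}\Big(\Big(\frac{\partial f_i}{\partial x}\Big)^2+\Big(\frac{\partial f_i}{\partial y}\Big)^2\Big)\Big)^{1/2}$$ be its Euclidean (Frobenius) norm. If $\|Jf\|$ is a constant function on $\mathbb{R}^2$, then $f$ is an affine map. -/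

import Mathlib

open scoped ContDiff

attribute [local instance] Matrix.frobeniusNormedAddCommGroup

/-- The plane `ℝ²` with its Euclidean structure. -/
abbrev Plane : Type := EuclideanSpace ℝ (Fin 2)

/-- The standard symplectic (area) form `dx ∧ dy` on `ℝ²`. -/
def areaForm (v w : Plane) : ℝ := v 0 * w 1 - v 1 * w 0

/-- A symplectomorphism of `ℝ²`: a smooth diffeomorphism of the whole plane onto itself that
pulls back the standard symplectic form to itself. -/
structure IsSymplectomorphism (f : Plane → Plane) : Prop where
  smooth : ContDiff ℝ ∞ f
  exists_smooth_inverse : ∃ g : Plane → Plane,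
    ContDiff ℝ ∞ g ∧ Function.LeftInverse g f ∧ Function.RightInverse g f
  preserves_form : ∀ x v w : Plane,
    areaForm (fderiv ℝ f x v) (fderiv ℝ f x w) = areaForm v w

/-- The Jacobian matrix of `f` at `x`: its `(i, j)` entry is the partial derivative in the
`j`-th coordinate direction of the `i`-th component of `f`. -/
noncomputable def jacobianMatrix (f : Plane → Plane) (x : Plane) : Matrix (Fin 2) (Fin 2) ℝ :=
  Matrix.of fun i j => (fderiv ℝ f x (EuclideanSpace.single j 1)) i

/-!
Read `f` as a map of `ℂ`. Its Wirtinger derivatives `p = ∂f` and `q = ∂̄f` satisfy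
`|p|² = (‖Jf‖² + 2 det Jf) / 4` and `|q|² = (‖Jf‖² - 2 det Jf) / 4`, so they have constant moduli
`a ≠ b`, and lift to `p = a e^{iα}`, `q = b e^{iβ}`. Put `e = e^{i(β-α)/2}`. The compatibility
condition `∂̄p = ∂q` says that `u = aα - bβ` is constant along `e` and that its derivative along
`I * e` is a constant multiple of the curvature `κ` of the lines orthogonal to `e`. Along the
integral curves of `e` one gets `κ' = -κ²`, whose only solution on all of `ℝ` is zero; hence `u` is
constant. Replacing `(b, β)` by `(-b, β + π)` changes nothing but gives that `aα + bβ` is constant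
as well, so `p` and `q` are constant.
-/

open Set Complex
open scoped ComplexConjugate Manifold

section ODE

variable {E : Type*} [NormedAddCommGroup E] [NormedSpace ℝ E] [ProperSpace E]

theorem exists_isIntegralCurve_of_norm_le {V : E → E} (hV : ContDiff ℝ 1 V) {M : ℝ}
    (hM : ∀ x, ‖V x‖ ≤ M) (x₀ : E) : ∃ γ : ℝ → E, γ 0 = x₀ ∧ IsIntegralCurve γ fun _ ↦ V := by
  lift M to NNReal using (norm_nonneg _).trans (hM x₀)
  have hlocal (T : ℝ) :
      ∃ γ : ℝ → E, γ 0 = x₀ ∧ IsMIntegralCurveOn (I := 𝓘(ℝ, E)) γ V (Ioo (-T) T) := by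
    have hT : -|T| ≤ 0 ∧ 0 ≤ |T| := by simp
    let r : NNReal := M * ‖T‖₊
    obtain ⟨K, hK⟩ := LocallyLipschitzOn.exists_lipschitzOnWith_of_compact
      (isCompact_closedBall x₀ r) hV.locallyLipschitz.locallyLipschitzOn
    have hPL : IsPicardLindelof (fun _ ↦ V) (⟨0, hT⟩ : Icc (-|T|) |T|) x₀ r 0 M K :=
      .of_time_independent (fun x _ ↦ hM x) hK (by simp [r])
    obtain ⟨γ, hγ₀, hγ⟩ := hPL.exists_eq_forall_mem_Icc_hasDerivWithinAt₀
    refine ⟨γ, hγ₀, fun t ht ↦ ?_⟩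
    have hsub : Ioo (-T) T ⊆ Icc (-|T|) |T| := fun t ht ↦
      ⟨by linarith [ht.1, le_abs_self T], by linarith [ht.2, le_abs_self T]⟩
    exact ((hγ t (hsub ht)).mono hsub).hasFDerivWithinAt.hasMFDerivWithinAt
  obtain ⟨γ, hγ₀, hγ⟩ := (exists_isMIntegralCurve_iff_exists_isMIntegralCurveOn_Ioo
    (contMDiff_vectorSpace_iff_contDiff.2 hV) x₀).2 hlocal
  exact ⟨γ, hγ₀, fun t ↦ (hγ t).hasFDerivAt⟩

theorem eq_zero_of_forall_hasDerivAt_neg_sq {q : ℝ → ℝ}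
    (hq : ∀ t, HasDerivAt q (-(q t) ^ 2) t) (t : ℝ) : q t = 0 := by
  have hcont : Continuous q := continuous_iff_continuousAt.2 fun t ↦ (hq t).continuousAt
  -- `y' = q y` linearises the Riccati equation to `y'' = 0`; a positive affine `y` is constant.
  let y : ℝ → ℝ := fun t ↦ Real.exp (∫ s in 0..t, q s)
  have hypos (t) : 0 < y t := Real.exp_pos _
  have hy (t) : HasDerivAt y (q t * y t) t := by
    simpa only [y, mul_comm] using (hcont.integral_hasStrictDerivAt 0 t).hasDerivAt.exp
  have hqy (s) : HasDerivAt (fun t ↦ q t * y t) 0 s :=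
    ((hq s).mul (hy s)).congr_deriv (by ring)
  have hslope (s) : q s * y s = q t * y t :=
    is_const_of_deriv_eq_zero (fun s ↦ (hqy s).differentiableAt) (fun s ↦ (hqy s).deriv) s t
  have hlin (s) : HasDerivAt (fun s ↦ y s - q t * y t * s) 0 s := by
    refine ((hy s).sub ((hasDerivAt_id s).const_mul (q t * y t))).congr_deriv ?_
    rw [hslope, mul_one, sub_self]
  have hzero : q t * y t = 0 := by
    by_contra hne
    have h := is_const_of_deriv_eq_zero (fun s ↦ (hlin s).differentiableAt)
      (fun s ↦ (hlin s).deriv) (-y 0 / (q t * y t)) 0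
    rw [mul_div_cancel₀ _ hne] at h
    linarith [hypos (-y 0 / (q t * y t))]
  exact (mul_eq_zero.1 hzero).resolve_right (hypos t).ne'

end ODE

section Arg
variable {E : Type*} [NormedAddCommGroup E] [NormedSpace ℝ E]

theorem exists_contDiff_cexp_eq {n : WithTop ℕ∞} {g : E → ℂ} (hg : ContDiff ℝ n g)
    (hg₀ : ∀ x, g x ≠ 0) : ∃ L : E → ℂ, ContDiff ℝ n L ∧ ∀ x, cexp (L x) = g x := by
  obtain ⟨L, ⟨-, hL⟩, -⟩ := isCoveringMapOn_exp.existsUnique_continuousMap_lifts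
    ⟨g, hg.continuous⟩ (exp_log (hg₀ 0)) hg₀
  replace hL (x) : cexp (L x) = g x := congrFun hL x
  refine ⟨L, contDiff_iff_contDiffAt.2 fun x ↦ ?_, hL⟩
  have him : ∀ᶠ y in nhds x, |(L y - L x).im| < Real.pi :=
    (by fun_prop : Continuous fun y ↦ |(L y - L x).im|).continuousAt.eventually_lt
      continuousAt_const (by simpa using Real.pi_pos)
  have hlog : L =ᶠ[nhds x] fun y ↦ L x + log (g y / g x) := by
    filter_upwards [him] with y hy
    rw [← hL, ← hL, ← exp_sub, log_exp (abs_lt.1 hy).1 (abs_lt.1 hy).2.le, add_sub_cancel]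
  have hlogx : ContDiffAt ℝ n log (g x / g x) :=
    (contDiffAt_log (by simp [hg₀ x])).restrict_scalars ℝ
  exact (contDiffAt_const.add (hlogx.comp x (hg.contDiffAt.div_const _))).congr_of_eventuallyEq
    hlog

/-- The field `x ↦ e^{iφ(x)}` of unit vectors of `ℂ` with angle function `φ`: both a direction field
of the plane and the phase of a function of constant modulus. -/
noncomputable def unitField {X : Type*} (φ : X → ℝ) (x : X) : ℂ := cexp (φ x * I)

theorem norm_unitField {X : Type*} (φ : X → ℝ) (x : X) : ‖unitField φ x‖ = 1 :=
  norm_exp_ofReal_mul_I (φ x)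

theorem contDiff_unitField {n : WithTop ℕ∞} {φ : E → ℝ} (hφ : ContDiff ℝ n φ) :
    ContDiff ℝ n (unitField φ) :=
  ((ofRealCLM.contDiff.comp hφ).mul contDiff_const).cexp

theorem hasFDerivAt_unitField {φ : E → ℝ} {φ' : E →L[ℝ] ℝ} {x : E} (hφ : HasFDerivAt φ φ' x) :
    HasFDerivAt (unitField φ) (φ'.smulRight (I * unitField φ x)) x := by
  refine ((ofRealCLM.hasFDerivAt.comp x hφ).mul_const I).cexp.congr_fderiv ?_
  ext v
  simp only [unitField, ContinuousLinearMap.smulRight_apply, smul_apply,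
    ContinuousLinearMap.comp_apply, ofRealCLM_apply, real_smul, smul_eq_mul, Function.comp_apply]
  ring

theorem unitField_ne_zero {X : Type*} (φ : X → ℝ) (x : X) : unitField φ x ≠ 0 :=
  exp_ne_zero _

theorem unitField_add {X : Type*} (φ ψ : X → ℝ) (x : X) :
    unitField (φ + ψ) x = unitField φ x * unitField ψ x := by
  rw [unitField, Pi.add_apply, ofReal_add, add_mul, exp_add, unitField, unitField]

theorem unitField_sub {X : Type*} (φ ψ : X → ℝ) (x : X) :
    unitField (φ - ψ) x = unitField φ x * conj (unitField ψ x) := by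
  rw [unitField, Pi.sub_apply, ofReal_sub, sub_mul, sub_eq_add_neg, exp_add, unitField, unitField,
    ← exp_conj, map_mul, conj_ofReal, conj_I, mul_neg]

theorem unitField_add_pi {X : Type*} (φ : X → ℝ) (x : X) :
    unitField (fun x ↦ φ x + Real.pi) x = -unitField φ x := by
  rw [unitField, ofReal_add, add_mul, exp_add, exp_pi_mul_I, mul_neg_one, unitField]

theorem exists_contDiff_eq_mul_unitField {n : WithTop ℕ∞} {g : E → ℂ} (hg : ContDiff ℝ n g)
    {r : ℝ} (hr : ∀ x, ‖g x‖ = r) :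
    ∃ θ : E → ℝ, ContDiff ℝ n θ ∧ g = fun x ↦ r * unitField θ x := by
  rcases eq_or_ne r 0 with rfl | hr₀
  · exact ⟨0, contDiff_const, funext fun x ↦ by simpa using hr x⟩
  obtain ⟨L, hL, hLg⟩ := exists_contDiff_cexp_eq hg fun x ↦ norm_ne_zero_iff.1 (hr x ▸ hr₀)
  refine ⟨fun x ↦ (L x).im, imCLM.contDiff.comp hL, funext fun x ↦ ?_⟩
  rw [← hr x, ← hLg x, norm_exp, ofReal_exp, unitField, ← exp_add, re_add_im]

end Arg

theorem fderiv_fderiv_mul_I_unitField {u φ : ℂ → ℝ} (hu : ContDiff ℝ 2 u) (hφ : ContDiff ℝ 1 φ)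
    (htangent : ∀ z, fderiv ℝ u z (unitField φ z) = 0) (z : ℂ) :
    fderiv ℝ (fun z ↦ fderiv ℝ u z (I * unitField φ z)) z (unitField φ z) =
      -(fderiv ℝ φ z (I * unitField φ z) * fderiv ℝ u z (I * unitField φ z)) := by
  set e := unitField φ
  have he : HasFDerivAt e ((fderiv ℝ φ z).smulRight (I * e z)) z :=
    hasFDerivAt_unitField (hφ.differentiable_one z).hasFDerivAt
  have hu' : HasFDerivAt (fderiv ℝ u) (fderiv ℝ (fderiv ℝ u) z) z :=
    ((hu.fderiv_right (m := 1) le_rfl).differentiable_one z).hasFDerivAt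
  have hsymm : fderiv ℝ (fderiv ℝ u) z (I * e z) (e z) = fderiv ℝ (fderiv ℝ u) z (e z) (I * e z) :=
    hu.contDiffAt.isSymmSndFDerivAt (by simp) _ _
  have htangent' : fderiv ℝ u z (fderiv ℝ φ z (I * e z) • (I * e z)) +
      fderiv ℝ (fderiv ℝ u) z (I * e z) (e z) = 0 := by
    have h := (hu'.clm_apply he).fderiv
    rw [show (fun z ↦ fderiv ℝ u z (e z)) = 0 from funext htangent, fderiv_zero] at h
    exact (DFunLike.congr_fun h (I * e z)).symm
  have hnormal : fderiv ℝ (fun z ↦ fderiv ℝ u z (I * e z)) z (e z) =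
      fderiv ℝ u z (I * fderiv ℝ φ z (e z) • (I * e z)) +
        fderiv ℝ (fderiv ℝ u) z (e z) (I * e z) := by
    rw [(hu'.clm_apply (he.const_mul I)).fderiv]
    rfl
  have hrot : I * fderiv ℝ φ z (e z) • (I * e z) = (-fderiv ℝ φ z (e z)) • e z := by
    rw [mul_smul_comm, ← mul_assoc, I_mul_I, neg_one_mul, smul_neg, neg_smul]
  rw [hnormal, hrot, ← hsymm, map_smul, htangent, smul_zero, zero_add]
  rw [map_smul, smul_eq_mul] at htangent'
  linarith

theorem continuousLinearMap_ext_of_apply_I_mul {F : Type*} [AddCommGroup F] [Module ℝ F]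
    [TopologicalSpace F] {A B : ℂ →L[ℝ] F} {e : ℂ} (he : e ≠ 0) (h : A e = B e)
    (hI : A (I * e) = B (I * e)) : A = B := by
  ext w
  have hw : w = (w / e).re • e + (w / e).im • (I * e) := by
    rw [real_smul, real_smul, ← mul_assoc, ← add_mul, re_add_im, div_mul_cancel₀ w he]
  rw [hw, map_add, map_add, map_smul, map_smul, map_smul, map_smul, h, hI]

theorem fderiv_eq_zero_of_fderiv_unitField_eq_zero {u φ : ℂ → ℝ} (hu : ContDiff ℝ 2 u)
    (hφ : ContDiff ℝ 1 φ) (htangent : ∀ z, fderiv ℝ u z (unitField φ z) = 0) {c : ℝ}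
    (hnormal : ∀ z, fderiv ℝ u z (I * unitField φ z) = c * fderiv ℝ φ z (I * unitField φ z))
    (z : ℂ) : fderiv ℝ u z = 0 := by
  refine continuousLinearMap_ext_of_apply_I_mul (unitField_ne_zero φ z) (htangent z) ?_
  rw [zero_apply]
  rcases eq_or_ne c 0 with rfl | hc
  · rw [hnormal, zero_mul]
  obtain ⟨γ, rfl, hγ⟩ := exists_isIntegralCurve_of_norm_le (contDiff_unitField hφ)
    (fun z ↦ (norm_unitField φ z).le) z
  let κ : ℂ → ℝ := fun z ↦ fderiv ℝ u z (I * unitField φ z) / c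
  have hκ (z) : fderiv ℝ φ z (I * unitField φ z) = κ z := by
    rw [eq_div_iff hc, hnormal, mul_comm]
  have hdiff : Differentiable ℝ fun z ↦ fderiv ℝ u z (I * unitField φ z) :=
    ((hu.fderiv_right (m := 1) le_rfl).clm_apply
      (contDiff_const.mul (contDiff_unitField hφ))).differentiable_one
  have hriccati (t) : HasDerivAt (κ ∘ γ) (-(κ (γ t)) ^ 2) t := by
    refine (((hdiff (γ t)).hasFDerivAt.comp_hasDerivAt t (hγ t)).div_const c).congr_deriv ?_
    rw [fderiv_fderiv_mul_I_unitField hu hφ htangent, hκ, sq, neg_div, mul_div_assoc]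
  rw [hnormal, hκ, show κ (γ 0) = 0 from eq_zero_of_forall_hasDerivAt_neg_sq hriccati 0, mul_zero]

theorem mul_apply_one_sub_I_mul_apply_I (L : ℂ →L[ℝ] ℝ) (w : ℂ) :
    w * (L 1 - I * L I) = L w - I * L (I * w) := by
  have hL (v : ℂ) : L v = v.re * L 1 + v.im * L I := by
    conv_lhs => rw [← re_add_im v, ← mul_one (v.re : ℂ), ← real_smul, ← real_smul]
    rw [map_add, map_smul, map_smul, smul_eq_mul, smul_eq_mul]
  rw [hL w, hL (I * w), I_mul_re, I_mul_im, ofReal_add, ofReal_add, ofReal_mul, ofReal_mul,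
    ofReal_mul, ofReal_mul, ofReal_neg]
  linear_combination -(L 1 - I * L I) * re_add_im w - w.im * L I * I_sq

theorem apply_eq_and_apply_I_mul_eq_neg {A B : ℂ →L[ℝ] ℝ} {a b : ℝ} {w e : ℂ} (hw : w ≠ 0)
    (h : a * (w * conj e) * (A 1 + I * A I) = b * (w * e) * (B 1 - I * B I)) :
    a * A e = b * B e ∧ a * A (I * e) = -(b * B (I * e)) := by
  have hconj := congrArg conj (mul_apply_one_sub_I_mul_apply_I A e)
  simp only [map_mul, map_sub, conj_ofReal, conj_I, neg_mul, sub_neg_eq_add] at hconj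
  have hframe : a * (A e + I * A (I * e)) = b * (B e - I * B (I * e)) := by
    refine mul_left_cancel₀ hw ?_
    rw [← hconj, ← mul_apply_one_sub_I_mul_apply_I]
    linear_combination h
  exact ⟨by simpa using congrArg re hframe, by simpa using congrArg im hframe⟩

theorem smul_fderiv_eq_smul_fderiv {α β : ℂ → ℝ} (hα : ContDiff ℝ 2 α) (hβ : ContDiff ℝ 2 β)
    {a b : ℝ} (hab : a + b ≠ 0)
    (h : ∀ z, a * unitField α z * (fderiv ℝ α z 1 + I * fderiv ℝ α z I) =
      b * unitField β z * (fderiv ℝ β z 1 - I * fderiv ℝ β z I)) (z : ℂ) :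
    a • fderiv ℝ α z = b • fderiv ℝ β z := by
  -- In the frame `e^{iφ}`, `I * e^{iφ}` the relation `h` splits into real and imaginary parts.
  let φ : ℂ → ℝ := (2 : ℝ)⁻¹ • (β - α)
  have hαφ : α + φ - φ = α := add_sub_cancel_right α φ
  have hβφ : α + φ + φ = β := by module
  have hφ : ContDiff ℝ 2 φ := contDiff_const.smul (hβ.sub hα)
  have hα' (z) : HasFDerivAt α (fderiv ℝ α z) z := (hα.differentiable two_ne_zero z).hasFDerivAt
  have hβ' (z) : HasFDerivAt β (fderiv ℝ β z) z := (hβ.differentiable two_ne_zero z).hasFDerivAt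
  have hφ' (z) : fderiv ℝ φ z = (2 : ℝ)⁻¹ • (fderiv ℝ β z - fderiv ℝ α z) :=
    (((hβ' z).sub (hα' z)).const_smul (2 : ℝ)⁻¹).fderiv
  have hu' (z) : fderiv ℝ (a • α - b • β) z = a • fderiv ℝ α z - b • fderiv ℝ β z :=
    (((hα' z).const_smul a).sub ((hβ' z).const_smul b)).fderiv
  have hframe (z) := apply_eq_and_apply_I_mul_eq_neg (unitField_ne_zero (α + φ) z)
    (e := unitField φ z) (by rw [← unitField_sub, ← unitField_add, hαφ, hβφ]; exact h z)
  rw [← sub_eq_zero, ← hu']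
  refine fderiv_eq_zero_of_fderiv_unitField_eq_zero (u := a • α - b • β)
    ((contDiff_const.smul hα).sub (contDiff_const.smul hβ)) (hφ.of_le one_le_two)
    (fun z ↦ ?_) (c := -4 * a * b / (a + b)) (fun z ↦ ?_) z
  · rw [hu', sub_apply, smul_apply, smul_apply, smul_eq_mul, smul_eq_mul, (hframe z).1,
      sub_self]
  · simp only [hu', hφ', sub_apply, smul_apply, smul_eq_mul]
    field_simp
    linear_combination 2 * (a - b) * (hframe z).2

/-- The Wirtinger derivative `∂G/∂z = (∂G/∂x - i ∂G/∂y) / 2`, for `G` differentiable over `ℝ`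
only. -/
noncomputable def wirtingerD (G : ℂ → ℂ) (z : ℂ) : ℂ :=
  (fderiv ℝ G z 1 - I * fderiv ℝ G z I) / 2

/-- The conjugate Wirtinger derivative `∂G/∂z̄ = (∂G/∂x + i ∂G/∂y) / 2`. -/
noncomputable def wirtingerDbar (G : ℂ → ℂ) (z : ℂ) : ℂ :=
  (fderiv ℝ G z 1 + I * fderiv ℝ G z I) / 2

theorem contDiff_wirtingerD {m n : WithTop ℕ∞} {G : ℂ → ℂ} (hG : ContDiff ℝ n G)
    (hmn : m + 1 ≤ n) : ContDiff ℝ m (wirtingerD G) := by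
  have hG' := hG.fderiv_right hmn
  exact ((hG'.clm_apply contDiff_const).sub
    (contDiff_const.mul (hG'.clm_apply contDiff_const))).div_const 2

theorem contDiff_wirtingerDbar {m n : WithTop ℕ∞} {G : ℂ → ℂ} (hG : ContDiff ℝ n G)
    (hmn : m + 1 ≤ n) : ContDiff ℝ m (wirtingerDbar G) := by
  have hG' := hG.fderiv_right hmn
  exact ((hG'.clm_apply contDiff_const).add
    (contDiff_const.mul (hG'.clm_apply contDiff_const))).div_const 2

theorem wirtingerDbar_wirtingerD {G : ℂ → ℂ} (hG : ContDiff ℝ 2 G) :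
    wirtingerDbar (wirtingerD G) = wirtingerD (wirtingerDbar G) := by
  ext z
  have hG' (v : ℂ) : HasFDerivAt (fun z ↦ fderiv ℝ G z v) ((fderiv ℝ (fderiv ℝ G) z).flip v) z := by
    simpa using ((hG.fderiv_right (m := 1) le_rfl).differentiable_one z).hasFDerivAt.clm_apply
      (hasFDerivAt_const v z)
  have hsymm : fderiv ℝ (fderiv ℝ G) z 1 I = fderiv ℝ (fderiv ℝ G) z I 1 :=
    hG.contDiffAt.isSymmSndFDerivAt (by simp) _ _
  have hD : HasFDerivAt (wirtingerD G) _ z :=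
    ((hG' 1).sub ((hG' I).const_mul I)).mul_const 2⁻¹
  have hDbar : HasFDerivAt (wirtingerDbar G) _ z :=
    ((hG' 1).add ((hG' I).const_mul I)).mul_const 2⁻¹
  rw [wirtingerDbar, hD.fderiv, wirtingerD, hDbar.fderiv]
  simp only [smul_apply, add_apply, sub_apply, ContinuousLinearMap.flip_apply, smul_eq_mul, hsymm]
  ring

theorem fderiv_apply_one (G : ℂ → ℂ) (z : ℂ) :
    fderiv ℝ G z 1 = wirtingerD G z + wirtingerDbar G z := by
  rw [wirtingerD, wirtingerDbar]
  ring

theorem fderiv_apply_I (G : ℂ → ℂ) (z : ℂ) :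
    fderiv ℝ G z I = I * (wirtingerD G z - wirtingerDbar G z) := by
  rw [wirtingerD, wirtingerDbar]
  linear_combination fderiv ℝ G z I * I_sq

theorem wirtingerD_mul_unitField {r : ℝ} {θ : ℂ → ℝ} {z : ℂ} (hθ : DifferentiableAt ℝ θ z) :
    wirtingerD (fun z ↦ r * unitField θ z) z =
      I / 2 * (r * unitField θ z * (fderiv ℝ θ z 1 - I * fderiv ℝ θ z I)) := by
  rw [wirtingerD, ((hasFDerivAt_unitField hθ.hasFDerivAt).const_mul (r : ℂ)).fderiv]
  simp only [smul_apply, ContinuousLinearMap.smulRight_apply, smul_eq_mul, real_smul]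
  ring

theorem wirtingerDbar_mul_unitField {r : ℝ} {θ : ℂ → ℝ} {z : ℂ} (hθ : DifferentiableAt ℝ θ z) :
    wirtingerDbar (fun z ↦ r * unitField θ z) z =
      I / 2 * (r * unitField θ z * (fderiv ℝ θ z 1 + I * fderiv ℝ θ z I)) := by
  rw [wirtingerDbar, ((hasFDerivAt_unitField hθ.hasFDerivAt).const_mul (r : ℂ)).fderiv]
  simp only [smul_apply, ContinuousLinearMap.smulRight_apply, smul_eq_mul, real_smul]
  ring

theorem fderiv_mul_unitField_eq_zero {r : ℝ} {θ : ℂ → ℝ} {z : ℂ} (hθ : DifferentiableAt ℝ θ z)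
    (h : r • fderiv ℝ θ z = 0) : fderiv ℝ (fun z ↦ r * unitField θ z) z = 0 := by
  rw [((hasFDerivAt_unitField hθ.hasFDerivAt).const_mul (r : ℂ)).fderiv]
  ext v
  have hv : (r : ℂ) * fderiv ℝ θ z v = 0 := mod_cast DFunLike.congr_fun h v
  simp only [smul_apply, ContinuousLinearMap.smulRight_apply, smul_eq_mul, real_smul, zero_apply]
  rw [← mul_assoc, hv, zero_mul]

theorem fderiv_eq_zero_of_norm_const {p q : ℂ → ℂ} (hp : ContDiff ℝ 2 p) (hq : ContDiff ℝ 2 q)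
    {a b : ℝ} (hpa : ∀ z, ‖p z‖ = a) (hqb : ∀ z, ‖q z‖ = b) (hab : a ≠ b)
    (hpq : wirtingerDbar p = wirtingerD q) (z : ℂ) : fderiv ℝ p z = 0 ∧ fderiv ℝ q z = 0 := by
  obtain ⟨α, hα, rfl⟩ := exists_contDiff_eq_mul_unitField hp hpa
  obtain ⟨β, hβ, rfl⟩ := exists_contDiff_eq_mul_unitField hq hqb
  have hα' : Differentiable ℝ α := hα.differentiable two_ne_zero
  have hβ' : Differentiable ℝ β := hβ.differentiable two_ne_zero
  have hcompat (z) : a * unitField α z * (fderiv ℝ α z 1 + I * fderiv ℝ α z I) =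
      b * unitField β z * (fderiv ℝ β z 1 - I * fderiv ℝ β z I) := by
    have h := congrFun hpq z
    rw [wirtingerDbar_mul_unitField (hα' z), wirtingerD_mul_unitField (hβ' z)] at h
    exact mul_left_cancel₀ (div_ne_zero I_ne_zero two_ne_zero) h
  have hsum : a + b ≠ 0 := by
    have ha : 0 ≤ a := hpa z ▸ norm_nonneg _
    have hb : 0 ≤ b := hqb z ▸ norm_nonneg _
    contrapose! hab
    linarith
  have hsub : a + -b ≠ 0 := by rwa [← sub_eq_add_neg, sub_ne_zero]
  have hplus : a • fderiv ℝ α z = b • fderiv ℝ β z :=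
    smul_fderiv_eq_smul_fderiv hα hβ hsum hcompat z
  -- The moduli may be signed, so `(-b, β + π)` describes the same `q` as `(b, β)`.
  have hminus : a • fderiv ℝ α z = -b • fderiv ℝ β z := by
    have h := smul_fderiv_eq_smul_fderiv hα (hβ.add (contDiff_const (c := Real.pi))) hsub
      (fun z ↦ ?_) z
    · rwa [fderiv_add_const] at h
    · rw [unitField_add_pi, fderiv_add_const, hcompat z, ofReal_neg, neg_mul_neg]
  have hβ₀ : b • fderiv ℝ β z = 0 := by
    rw [hplus, neg_smul, ← add_eq_zero_iff_eq_neg, ← two_smul ℝ] at hminus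
    exact (smul_eq_zero.1 hminus).resolve_left two_ne_zero
  exact ⟨fderiv_mul_unitField_eq_zero (hα' z) (hplus.trans hβ₀),
    fderiv_mul_unitField_eq_zero (hβ' z) hβ₀⟩

theorem exists_affineMap_of_fderiv_eq_fderiv_zero {E F : Type*} [NormedAddCommGroup E]
    [NormedSpace ℝ E] [NormedAddCommGroup F] [NormedSpace ℝ F] {f : E → F}
    (hf : Differentiable ℝ f) (h : ∀ x, fderiv ℝ f x = fderiv ℝ f 0) :
    ∃ g : E →ᵃ[ℝ] F, ∀ x, f x = g x := by
  let g : E →ᵃ[ℝ] F := (fderiv ℝ f 0 : E →ₗ[ℝ] F).toAffineMap + AffineMap.const ℝ E (f 0)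
  have hg (x) : HasFDerivAt g (fderiv ℝ f 0) x := (fderiv ℝ f 0).hasFDerivAt.add_const (f 0)
  exact ⟨g, fun x ↦ congrFun (eq_of_fderiv_eq hf (fun x ↦ (hg x).differentiableAt)
    (fun x ↦ (h x).trans (hg x).fderiv.symm) 0 (by simp [g])) x⟩

theorem exists_affineMap_of_norm_wirtinger_const {G : ℂ → ℂ} (hG : ContDiff ℝ 3 G) {a b : ℝ}
    (ha : ∀ z, ‖wirtingerD G z‖ = a) (hb : ∀ z, ‖wirtingerDbar G z‖ = b) (hab : a ≠ b) :
    ∃ g : ℂ →ᵃ[ℝ] ℂ, ∀ z, G z = g z := by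
  have hD : ContDiff ℝ 2 (wirtingerD G) := contDiff_wirtingerD hG (by norm_num)
  have hDbar : ContDiff ℝ 2 (wirtingerDbar G) := contDiff_wirtingerDbar hG (by norm_num)
  have hzero := fderiv_eq_zero_of_norm_const hD hDbar ha hb hab
    (wirtingerDbar_wirtingerD (hG.of_le (by norm_num)))
  have hDconst (z) : wirtingerD G z = wirtingerD G 0 :=
    is_const_of_fderiv_eq_zero (hD.differentiable two_ne_zero) (fun z ↦ (hzero z).1) z 0
  have hDbarconst (z) : wirtingerDbar G z = wirtingerDbar G 0 :=
    is_const_of_fderiv_eq_zero (hDbar.differentiable two_ne_zero) (fun z ↦ (hzero z).2) z 0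
  refine exists_affineMap_of_fderiv_eq_fderiv_zero (hG.differentiable three_ne_zero) fun z ↦
    continuousLinearMap_ext_of_apply_I_mul one_ne_zero ?_ ?_
  · rw [fderiv_apply_one, fderiv_apply_one, hDconst, hDbarconst]
  · rw [mul_one, fderiv_apply_I, fderiv_apply_I, hDconst, hDbarconst]

/-- The identification of `ℂ` with the Euclidean plane sending `1`, `I` to the standard basis. -/
noncomputable def planeEquiv : ℂ ≃L[ℝ] Plane :=
  orthonormalBasisOneI.repr.toContinuousLinearEquiv

theorem planeEquiv_one : planeEquiv 1 = EuclideanSpace.single 0 1 := by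
  simpa [planeEquiv] using orthonormalBasisOneI.repr_self 0

theorem planeEquiv_I : planeEquiv I = EuclideanSpace.single 1 1 := by
  simpa [planeEquiv] using orthonormalBasisOneI.repr_self 1

theorem planeEquiv_symm_apply (y : Plane) : planeEquiv.symm y = y 0 + y 1 * I := by
  obtain ⟨w, rfl⟩ := planeEquiv.surjective y
  rw [planeEquiv.symm_apply_apply]
  simp [planeEquiv]

/-- A map of the plane read as a map of `ℂ` through `planeEquiv`, so that it has Wirtinger
derivatives. -/
noncomputable def toComplex (f : Plane → Plane) : ℂ → ℂ :=
  planeEquiv.symm ∘ f ∘ planeEquiv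

theorem fderiv_toComplex (f : Plane → Plane) (z v : ℂ) :
    fderiv ℝ (toComplex f) z v = planeEquiv.symm (fderiv ℝ f (planeEquiv z) (planeEquiv v)) := by
  rw [toComplex, planeEquiv.symm.comp_fderiv, planeEquiv.comp_right_fderiv]
  rfl

theorem fderiv_toComplex_one (f : Plane → Plane) (z : ℂ) :
    fderiv ℝ (toComplex f) z 1 =
      jacobianMatrix f (planeEquiv z) 0 0 + jacobianMatrix f (planeEquiv z) 1 0 * I := by
  rw [fderiv_toComplex, planeEquiv_one, planeEquiv_symm_apply]
  rfl

theorem fderiv_toComplex_I (f : Plane → Plane) (z : ℂ) :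
    fderiv ℝ (toComplex f) z I =
      jacobianMatrix f (planeEquiv z) 0 1 + jacobianMatrix f (planeEquiv z) 1 1 * I := by
  rw [fderiv_toComplex, planeEquiv_I, planeEquiv_symm_apply]
  rfl

theorem frobenius_norm_sq_fin_two (A : Matrix (Fin 2) (Fin 2) ℝ) :
    ‖A‖ ^ 2 = A 0 0 ^ 2 + A 0 1 ^ 2 + (A 1 0 ^ 2 + A 1 1 ^ 2) := by
  rw [Matrix.frobenius_norm_def, ← Real.sqrt_eq_rpow, Real.sq_sqrt (by positivity)]
  simp [Fin.sum_univ_two]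

theorem norm_wirtingerD_toComplex_sq (f : Plane → Plane) (z : ℂ) :
    ‖wirtingerD (toComplex f) z‖ ^ 2 =
      (‖jacobianMatrix f (planeEquiv z)‖ ^ 2 + 2 * (jacobianMatrix f (planeEquiv z)).det) / 4 := by
  set A := jacobianMatrix f (planeEquiv z)
  have h : wirtingerD (toComplex f) z =
      ((A 0 0 + A 1 1) / 2 : ℝ) + ((A 1 0 - A 0 1) / 2 : ℝ) * I := by
    rw [wirtingerD, fderiv_toComplex_one, fderiv_toComplex_I]
    push_cast
    linear_combination -(A 1 1 / 2 : ℂ) * I_sq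
  rw [h, Complex.sq_norm, normSq_add_mul_I, frobenius_norm_sq_fin_two, Matrix.det_fin_two]
  ring

theorem norm_wirtingerDbar_toComplex_sq (f : Plane → Plane) (z : ℂ) :
    ‖wirtingerDbar (toComplex f) z‖ ^ 2 =
      (‖jacobianMatrix f (planeEquiv z)‖ ^ 2 - 2 * (jacobianMatrix f (planeEquiv z)).det) / 4 := by
  set A := jacobianMatrix f (planeEquiv z)
  have h : wirtingerDbar (toComplex f) z =
      ((A 0 0 - A 1 1) / 2 : ℝ) + ((A 1 0 + A 0 1) / 2 : ℝ) * I := by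
    rw [wirtingerDbar, fderiv_toComplex_one, fderiv_toComplex_I]
    push_cast
    linear_combination (A 1 1 / 2 : ℂ) * I_sq
  rw [h, Complex.sq_norm, normSq_add_mul_I, frobenius_norm_sq_fin_two, Matrix.det_fin_two]
  ring

theorem IsSymplectomorphism.det_jacobianMatrix {f : Plane → Plane} (hf : IsSymplectomorphism f)
    (x : Plane) : (jacobianMatrix f x).det = 1 := by
  have h := hf.preserves_form x (EuclideanSpace.single 0 1) (EuclideanSpace.single 1 1)
  rw [Matrix.det_fin_two]
  simpa [areaForm, jacobianMatrix, mul_comm] using h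

theorem mainTheorem11_general {f : Plane → Plane} (hf : ContDiff ℝ 3 f) {d : ℝ} (hd : d ≠ 0)
    (hdet : ∀ x, (jacobianMatrix f x).det = d) {c : ℝ} (hnorm : ∀ x, ‖jacobianMatrix f x‖ = c) :
    ∃ g : Plane →ᵃ[ℝ] Plane, ∀ x, f x = g x := by
  have hD (z) : ‖wirtingerD (toComplex f) z‖ = √((c ^ 2 + 2 * d) / 4) := by
    rw [← hnorm (planeEquiv z), ← hdet (planeEquiv z), ← norm_wirtingerD_toComplex_sq,
      Real.sqrt_sq (norm_nonneg _)]
  have hDbar (z) : ‖wirtingerDbar (toComplex f) z‖ = √((c ^ 2 - 2 * d) / 4) := by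
    rw [← hnorm (planeEquiv z), ← hdet (planeEquiv z), ← norm_wirtingerDbar_toComplex_sq,
      Real.sqrt_sq (norm_nonneg _)]
  have hne : √((c ^ 2 + 2 * d) / 4) ≠ √((c ^ 2 - 2 * d) / 4) := by
    intro h
    have hsq := congrArg (· ^ 2) h
    simp only [← hD 0, ← hDbar 0, norm_wirtingerD_toComplex_sq,
      norm_wirtingerDbar_toComplex_sq, hdet] at hsq
    exact hd (by linarith)
  obtain ⟨g, hg⟩ := exists_affineMap_of_norm_wirtinger_const
    (planeEquiv.symm.contDiff.comp (hf.comp planeEquiv.contDiff)) hD hDbar hne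
  refine ⟨(planeEquiv : ℂ →ₗ[ℝ] Plane).toAffineMap.comp
    (g.comp (planeEquiv.symm : Plane →ₗ[ℝ] ℂ).toAffineMap), fun x ↦ ?_⟩
  have hx := congrArg planeEquiv (hg (planeEquiv.symm x))
  simpa using hx

theorem mainTheorem11 (f : Plane → Plane) (hf : IsSymplectomorphism f)
    (hJ : ∃ c : ℝ, ∀ x : Plane, ‖jacobianMatrix f x‖ = c) :
    ∃ g : Plane →ᵃ[ℝ] Plane, ∀ x : Plane, f x = g x :=
  mainTheorem11_general (contDiff_infty.1 hf.smooth 3) one_ne_zero hf.det_jacobianMatrix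
    hJ.choose_spec
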